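/- Let $K$ be a field, let $n\ge 0$, and let $\mathbf a=(a_1,\dots,a_r)$ be a sequence of positive integers with $a_1+\dots+a_r=n$. Put $\alpha_0=0$, $\alpha_t=a_1+\dots+a_t$ and $I_t=\{\alpha_{t-1}+1,\dots,\alpha_t\}$ for $1\le t\le r$. Let $R=K[x_i,y_i,z_i : 1\le i\le n]$, let $X$ be the generic $3\times n$ matrix with rows $(x_1,\dots,x_n)$, $(y_1,\dots,y_n)$, $(z_1,\dots,z_n)$, and let $I_X\subseteq R$ be the ideal generated by the maximal ($3\times 3$) minors of $X$. The matching field ideal $M_{\mathbf a}\subseteq R$ is generated by the monomials $m_{ijk}$, for all $1\le i<j<k\le n$, where, with $s$ the smallest $t$ such that $I_t\cap\{i,j,k\}\ne\emptyset$, $$m_{ijk}=\begin{cases}x_jy_iz_k&\text{if }|\{i,j,k\}\cap I_s|=1,\\ x_iy_jz_k&\text{otherwise.}\end{cases}$$ Fix a real number $w_0\ge 0$ and give the variables the weights $$w_{\mathbf a}(x_i)=w_0,\qquad w_{\mathbf a}(y_j)=w_0+(j-\alpha_{s-1})+(n-\alpha_s)\ \text{ for } j\in I_s,$$ $$w_{\mathbf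 a}(z_1)=w_{\mathbf a}(z_2)=w_0,\qquad w_{\mathbf a}(z_i)=w_{\mathbf a}(y_{\alpha_1})+(n-2)(i-2)\ \text{ for } 3\le i\le n.$$ (So the $y$-weights run through $w_0+1,\dots,w_0+n$, going through the last block $I_r$ first, in increasing order of the index, then through $I_{r-1}$, and so on up to $I_1$; in particular $w_{\mathbf a}(y_{\alpha_1})=w_0+n$.) Let $\prec_{w_{\mathbf a}}$ be the monomial order on $R$ that compares monomials first by their weight and, for equal weights, by the (graded) reverse lexicographic order induced by $$z_n>\dots>z_3>y_{\alpha_1}>\dots>y_{\alpha_0+1}>y_{\alpha_2}>\dots>y_{\alpha_1+1}>\dots>y_{\alpha_r}>\dots>y_{\alpha_{r-1}+1}>z_2>z_1>x_1>\dots>x_n;$$ that is, for monomials $m,m'$ of equal weight, $m$ is smaller than $m'$ if $\deg m<\deg m'$, or if $\deg m=\deg m'$ and the smallest variable whose exponents in $m$ and $m'$ differ has the larger exponent in $m$. Then $M_{\mathbf a}$ is the initial ideal of $I_X$ with respect to $\prec_{w_{\mathbf a}}$, that is, the ideal generated by the leading terms of all elements of $I_X$. In particular, the maximal minors of $X$ form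 a Gröbner basis of $I_X$ with respect to $\prec_{w_{\mathbf a}}$. -/

import Mathlib

open MvPolynomial
open scoped NNReal MonomialOrder

/-! ### Weight orders refined by the (graded) reverse lexicographic order -/

/-- The strict relation `e ≺ f` on exponent vectors: `e` has smaller `w`-weight than `f`, or the
weights agree and `e` is smaller than `f` in the (graded) reverse lexicographic order for the order
of the variables in which `v` is larger than `u` when `rank u < rank v`. The latter means:
`deg e < deg f`, or the degrees agree and, for the smallest variable `v` in which the exponents
differ, the exponent of `v` in `e` is the larger one. -/
def WeightRevLexLT {σ : Type*} (w : σ → ℝ≥0) (rank : σ → ℕ) (e f : σ →₀ ℕ) : Prop :=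
  Finsupp.weight w e < Finsupp.weight w f ∨
    (Finsupp.weight w e = Finsupp.weight w f ∧
      (e.degree < f.degree ∨
        (e.degree = f.degree ∧ ∃ v, f v < e v ∧ ∀ u, rank u < rank v → e u = f u)))

theorem WeightRevLexLT.irrefl {σ : Type*} (w : σ → ℝ≥0) (rank : σ → ℕ) (e : σ →₀ ℕ) :
    ¬ WeightRevLexLT w rank e e := by
  rintro (h | ⟨-, h | ⟨-, v, h, -⟩⟩) <;> exact lt_irrefl _ h

theorem WeightRevLexLT.trans {σ : Type*} {w : σ → ℝ≥0} {rank : σ → ℕ}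
    (hr : Function.Injective rank) {e f g : σ →₀ ℕ}
    (h₁ : WeightRevLexLT w rank e f) (h₂ : WeightRevLexLT w rank f g) :
    WeightRevLexLT w rank e g := by
  rcases h₁ with h₁ | ⟨h₁, k₁⟩
  · rcases h₂ with h₂ | ⟨h₂, -⟩
    · exact Or.inl (h₁.trans h₂)
    · exact Or.inl (h₂ ▸ h₁)
  rcases h₂ with h₂ | ⟨h₂, k₂⟩
  · exact Or.inl (h₁ ▸ h₂)
  refine Or.inr ⟨h₁.trans h₂, ?_⟩
  rcases k₁ with k₁ | ⟨k₁, v, hv, hv'⟩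
  · rcases k₂ with k₂ | ⟨k₂, -⟩
    · exact Or.inl (k₁.trans k₂)
    · exact Or.inl (k₂ ▸ k₁)
  rcases k₂ with k₂ | ⟨k₂, u, hu, hu'⟩
  · exact Or.inl (k₁ ▸ k₂)
  refine Or.inr ⟨k₁.trans k₂, ?_⟩
  rcases lt_trichotomy (rank v) (rank u) with h | h | h
  · exact ⟨v, by rw [← hu' v h]; exact hv, fun x hx => (hv' x hx).trans (hu' x (hx.trans h))⟩
  · obtain rfl := hr h
    exact ⟨v, hu.trans hv, fun x hx => (hv' x hx).trans (hu' x hx)⟩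
  · exact ⟨u, by rw [hv' u h]; exact hu, fun x hx => (hv' x (hx.trans h)).trans (hu' x hx)⟩

theorem WeightRevLexLT.trichotomous {σ : Type*} (w : σ → ℝ≥0) (rank : σ → ℕ) (e f : σ →₀ ℕ) :
    WeightRevLexLT w rank e f ∨ e = f ∨ WeightRevLexLT w rank f e := by
  classical
  by_cases hef : e = f
  · exact Or.inr (Or.inl hef)
  rcases lt_trichotomy (Finsupp.weight w e) (Finsupp.weight w f) with h | h | h
  · exact Or.inl (Or.inl h)
  · rcases lt_trichotomy e.degree f.degree with h' | h' | h'
    · exact Or.inl (Or.inr ⟨h, Or.inl h'⟩)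
    · have hex : ∃ k, ∃ v, rank v = k ∧ e v ≠ f v := by
        obtain ⟨v, hv⟩ := DFunLike.ne_iff.1 hef
        exact ⟨_, v, rfl, hv⟩
      obtain ⟨v, hv, hne⟩ := Nat.find_spec hex
      have hmin : ∀ u, rank u < rank v → e u = f u := by
        intro u hu
        by_contra hc
        exact Nat.find_min hex (hv ▸ hu) ⟨u, rfl, hc⟩
      rcases lt_or_gt_of_ne hne with hlt | hlt
      · exact Or.inr (Or.inr (Or.inr ⟨h.symm, Or.inr ⟨h'.symm, v, hlt,
          fun u hu => (hmin u hu).symm⟩⟩))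
      · exact Or.inl (Or.inr ⟨h, Or.inr ⟨h', v, hlt, hmin⟩⟩)
    · exact Or.inr (Or.inr (Or.inr ⟨h.symm, Or.inl h'⟩))
  · exact Or.inr (Or.inr (Or.inl h))

theorem WeightRevLexLT.add_left {σ : Type*} {w : σ → ℝ≥0} {rank : σ → ℕ} {e f : σ →₀ ℕ}
    (h : WeightRevLexLT w rank e f) (g : σ →₀ ℕ) : WeightRevLexLT w rank (g + e) (g + f) := by
  unfold WeightRevLexLT at h ⊢
  simpa [map_add] using h

theorem WeightRevLexLT.of_lt {σ : Type*} (w : σ → ℝ≥0) (rank : σ → ℕ) {e f : σ →₀ ℕ}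
    (h : e < f) : WeightRevLexLT w rank e f := by
  obtain ⟨g, rfl⟩ := exists_add_of_le h.le
  have hg : g ≠ 0 := by
    rintro rfl
    simp at h
  have hd : 0 < g.degree := Nat.pos_of_ne_zero (mt (Finsupp.degree_eq_zero_iff g).1 hg)
  rcases (zero_le : 0 ≤ Finsupp.weight w g).lt_or_eq with hw | hw
  · exact Or.inl (by rw [map_add]; exact lt_add_of_pos_right _ hw)
  · refine Or.inr ⟨by rw [map_add, ← hw, add_zero], Or.inl ?_⟩
    rw [map_add]
    exact Nat.lt_add_of_pos_right hd

/-- Type synonym of `σ →₀ ℕ`, to carry the linear order `WeightRevLexLT w rank`. -/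
def WeightRevLexSyn {σ : Type*} (_w : σ → ℝ≥0) (_rank : σ → ℕ) : Type _ := σ →₀ ℕ

noncomputable instance {σ : Type*} (w : σ → ℝ≥0) (rank : σ → ℕ) :
    AddCommMonoid (WeightRevLexSyn w rank) :=
  inferInstanceAs (AddCommMonoid (σ →₀ ℕ))

/-- The linear order on exponent vectors whose strict relation is `WeightRevLexLT w rank`. -/
noncomputable abbrev weightRevLexLinearOrder {σ : Type*} (w : σ → ℝ≥0) (rank : σ → ℕ)
    (hr : Function.Injective rank) : LinearOrder (WeightRevLexSyn w rank) where
  le e f := e = f ∨ WeightRevLexLT w rank e f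
  lt e f := WeightRevLexLT w rank e f
  le_refl _ := Or.inl rfl
  le_trans := by
    rintro e f g (rfl | h₁) (rfl | h₂)
    · exact Or.inl rfl
    · exact Or.inr h₂
    · exact Or.inr h₁
    · exact Or.inr (h₁.trans hr h₂)
  lt_iff_le_not_ge := by
    intro e f
    constructor
    · intro h
      refine ⟨Or.inr h, ?_⟩
      rintro (rfl | h')
      · exact WeightRevLexLT.irrefl _ _ _ h
      · exact WeightRevLexLT.irrefl _ _ _ (h.trans hr h')
    · rintro ⟨rfl | h, h'⟩
      · exact absurd (Or.inl rfl) h'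
      · exact h
  le_antisymm := by
    rintro e f (h | h₁) (h' | h₂)
    · exact h
    · exact h
    · exact h'.symm
    · exact absurd (h₁.trans hr h₂) (WeightRevLexLT.irrefl _ _ _)
  le_total := by
    intro e f
    rcases WeightRevLexLT.trichotomous w rank e f with h | h | h
    · exact Or.inl (Or.inr h)
    · exact Or.inl (Or.inl h)
    · exact Or.inr (Or.inr h)
  toDecidableLE := Classical.decRel _

/-- The monomial order that compares the `w`-weights first and breaks ties by the (graded) reverse
lexicographic order for the order of the variables given by `rank`. -/
noncomputable def weightRevLex {σ : Type*} [Finite σ] (w : σ → ℝ≥0) (rank : σ → ℕ)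
    (hr : Function.Injective rank) : MonomialOrder σ :=
  letI : LinearOrder (WeightRevLexSyn w rank) := weightRevLexLinearOrder w rank hr
  { syn := WeightRevLexSyn w rank
    isOrderedAddMonoid_syn :=
      { add_le_add_left := by
          rintro e f (rfl | h) g
          · exact Or.inl rfl
          · refine Or.inr ?_
            have := h.add_left g
            rw [add_comm e g, add_comm f g]
            exact this }
    toSyn :=
      { toFun := fun e => e
        invFun := fun e => e
        left_inv := fun _ => rfl
        right_inv := fun _ => rfl
        map_add' := fun _ _ => rfl }
    toSyn_monotone := by
      intro e f h
      rcases h.eq_or_lt with rfl | h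
      · exact Or.inl rfl
      · exact Or.inr (WeightRevLexLT.of_lt w rank h)
    wellFoundedLT_syn := by
      refine ⟨RelEmbedding.wellFounded_iff_isEmpty.2 ⟨fun s => ?_⟩⟩
      obtain ⟨i, j, hij, hle⟩ := wellQuasiOrdered_le (α := σ →₀ ℕ) (fun i => s i)
      have h₁ : WeightRevLexLT w rank (s j) (s i) := s.map_rel_iff.2 hij
      rcases hle.eq_or_lt with h | h
      · have h' : s i = s j := h
        rw [h'] at h₁
        exact WeightRevLexLT.irrefl _ _ _ h₁
      · exact WeightRevLexLT.irrefl _ _ _ (h₁.trans hr (WeightRevLexLT.of_lt w rank h)) }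

theorem weightRevLex_lt_iff {σ : Type*} [Finite σ] (w : σ → ℝ≥0) (rank : σ → ℕ)
    (hr : Function.Injective rank) (e f : σ →₀ ℕ) :
    e ≺[weightRevLex w rank hr] f ↔ WeightRevLexLT w rank e f := Iff.rfl

/-! ### Initial ideals and Gröbner bases -/

/-- The initial ideal of `I`: the ideal generated by the leading terms of the elements of `I`. -/
noncomputable def initialIdeal {σ K : Type*} [Field K] (m : MonomialOrder σ)
    (I : Ideal (MvPolynomial σ K)) : Ideal (MvPolynomial σ K) :=
  Ideal.span (m.leadingTerm '' (I : Set (MvPolynomial σ K)))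

/-- `G` is a Gröbner basis of `I`: a finite subset of `I` whose leading terms generate the initial
ideal of `I`. -/
def IsGroebnerBasis {σ K : Type*} [Field K] (m : MonomialOrder σ)
    (G : Set (MvPolynomial σ K)) (I : Ideal (MvPolynomial σ K)) : Prop :=
  G.Finite ∧ G ⊆ I ∧ Ideal.span (m.leadingTerm '' G) = initialIdeal m I

/-! ### The ideal of maximal minors

The variables of the generic `3 × n` matrix are indexed by `Fin 3 × Fin n`; with `0`-based indices,
`X (0, i)`, `X (1, i)`, `X (2, i)` are the variables `x`, `y`, `z` in column `i`. A `3`-subset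
`{i < j < k}` of the columns is an order embedding `c : Fin 3 ↪o Fin n`. -/

/-- The maximal minor on the columns `c 0 < c 1 < c 2` of the generic `3 × n` matrix. -/
noncomputable def maximalMinor (K : Type*) [Field K] {n : ℕ} (c : Fin 3 ↪o Fin n) :
    MvPolynomial (Fin 3 × Fin n) K :=
  ((Matrix.mvPolynomialX (Fin 3) (Fin n) K).submatrix id c).det

/-- The ideal generated by the maximal minors of the generic `3 × n` matrix. -/
noncomputable def minorIdeal (K : Type*) [Field K] (n : ℕ) :
    Ideal (MvPolynomial (Fin 3 × Fin n) K) :=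
  Ideal.span (Set.range fun c : Fin 3 ↪o Fin n => maximalMinor K c)

/-! ### Block diagonal matching fields

The type `a = (a₁, …, aᵣ)` is a composition of `n`; its blocks `I₁, …, Iᵣ` are the consecutive
intervals of lengths `a₁, …, aᵣ`, and `a.index j` is the number of the block that contains the
column `j`. -/

/-- The first block that meets the `3`-subset `c`. -/
def firstBlock {n : ℕ} (a : Composition n) (c : Fin 3 ↪o Fin n) : Fin a.length :=
  Finset.univ.inf' Finset.univ_nonempty fun p => a.index (c p)

/-- The monomial of the `3`-subset `{i < j < k}`: it is `x_j y_i z_k` if the first block that meets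
the subset contains exactly one of its elements, and `x_i y_j z_k` otherwise. -/
noncomputable def matchingMonomial (K : Type*) [Field K] {n : ℕ} (a : Composition n)
    (c : Fin 3 ↪o Fin n) : MvPolynomial (Fin 3 × Fin n) K :=
  if (Finset.univ.filter fun p => a.index (c p) = firstBlock a c).card = 1 then
    X (0, c 1) * X (1, c 0) * X (2, c 2)
  else
    X (0, c 0) * X (1, c 1) * X (2, c 2)

/-- The matching field ideal of type `a`. -/
noncomputable def matchingFieldIdeal (K : Type*) [Field K] {n : ℕ} (a : Composition n) :
    Ideal (MvPolynomial (Fin 3 × Fin n) K) :=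
  Ideal.span (Set.range fun c : Fin 3 ↪o Fin n => matchingMonomial K a c)

/-! ### The weight order of a block diagonal matching field -/

/-- For `j ∈ I_s` this is (with `1`-based `j`) `j - α_{s-1} + (n - α_s)`, where
`α_s = a₁ + ⋯ + a_s`: the place of `y_j` in the increasing sequence
`y_{α_{r-1}+1}, …, y_{α_r}, y_{α_{r-2}+1}, …, y_{α_{r-1}}, …, y_1, …, y_{α_1}`. -/
def yPlace {n : ℕ} (a : Composition n) (j : Fin n) : ℕ :=
  ((j : ℕ) + 1 - a.sizeUpTo (a.index j)) + (n - a.sizeUpTo (a.index j + 1))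

/-- The weight of the variable `v`, where `w₀` is the common weight of the `x`-variables. With
`1`-based indices: `w(x_i) = w₀`; `w(y_j) = w₀ + yPlace j`; `w(z_1) = w(z_2) = w₀`; and
`w(z_i) = (w₀ + n) + (n - 2) * (i - 2)` for `3 ≤ i`, where `w₀ + n` is the weight of `y_{α_1}`. -/
noncomputable def matchingWeight {n : ℕ} (a : Composition n) (w₀ : ℝ≥0) (v : Fin 3 × Fin n) :
    ℝ≥0 :=
  match v with
  | (0, _) => w₀
  | (1, j) => w₀ + yPlace a j
  | (2, i) => if (i : ℕ) < 2 then w₀ else (w₀ + n) + ((n - 2) * ((i : ℕ) + 1 - 2) : ℕ)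

/-- The place of the variable `v` in the increasing sequence of variables
`x_n, …, x_1, z_1, z_2`, then the `y`-variables in the order given by `yPlace`, then
`z_3, …, z_n`. -/
def matchingRank {n : ℕ} (a : Composition n) (v : Fin 3 × Fin n) : ℕ :=
  match v with
  | (0, i) => n - ((i : ℕ) + 1)
  | (1, j) => n + 1 + yPlace a j
  | (2, i) => if (i : ℕ) < 2 then n + i else 2 * n + i

theorem yPlace_pos {n : ℕ} (a : Composition n) (j : Fin n) : 0 < yPlace a j := by
  have := a.sizeUpTo_index_le j
  unfold yPlace
  omega

theorem yPlace_le {n : ℕ} (a : Composition n) (j : Fin n) : yPlace a j ≤ n := by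
  have h₁ := a.sizeUpTo_index_le j
  have h₂ := a.lt_sizeUpTo_index_succ j
  have h₃ := a.sizeUpTo_le (a.index j + 1)
  simp only [Fin.val_succ] at h₂
  unfold yPlace
  omega

/-- The order of the `y`-variables: earlier blocks are larger, and inside a block larger indices
are larger. -/
theorem yPlace_lt_iff {n : ℕ} (a : Composition n) (i j : Fin n) :
    yPlace a i < yPlace a j ↔
      a.index j < a.index i ∨ (a.index j = a.index i ∧ i < j) := by
  have key : ∀ i j : Fin n, a.index j < a.index i → yPlace a i < yPlace a j := by
    intro i j h
    have h₁ := a.sizeUpTo_index_le j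
    have h₂ := a.lt_sizeUpTo_index_succ i
    have h₃ := a.sizeUpTo_le (a.index i + 1)
    have h₄ : a.sizeUpTo (a.index j + 1) ≤ a.sizeUpTo (a.index i) :=
      a.monotone_sizeUpTo (Nat.succ_le_of_lt h)
    have h₅ := a.sizeUpTo_index_le i
    simp only [Fin.val_succ] at h₂
    unfold yPlace
    omega
  rcases lt_trichotomy (a.index j) (a.index i) with h | h | h
  · exact iff_of_true (key i j h) (Or.inl h)
  · have h₁ := a.sizeUpTo_index_le j
    have h₂ := a.sizeUpTo_index_le i
    simp only [h, lt_irrefl, true_and, false_or]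
    rw [h] at h₁
    rw [Fin.lt_def]
    unfold yPlace
    rw [h]
    omega
  · refine iff_of_false (key j i h).not_gt ?_
    rintro (h' | ⟨h', -⟩)
    · exact absurd h' h.not_gt
    · exact absurd h' h.ne'

theorem yPlace_injective {n : ℕ} (a : Composition n) : Function.Injective (yPlace a) := by
  intro i j h
  have h₁ := (yPlace_lt_iff a i j).not.1 h.not_lt
  have h₂ := (yPlace_lt_iff a j i).not.1 h.not_gt
  push Not at h₁ h₂
  have h₃ := le_antisymm h₂.1 h₁.1
  exact le_antisymm (h₂.2 h₃.symm) (h₁.2 h₃)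

theorem matchingRank_injective {n : ℕ} (a : Composition n) :
    Function.Injective (matchingRank a) := by
  rintro ⟨p, i⟩ ⟨q, j⟩ h
  have hi := i.2
  have hj := j.2
  have h₁ := yPlace_pos a i
  have h₂ := yPlace_pos a j
  have h₃ := yPlace_le a i
  have h₄ := yPlace_le a j
  fin_cases p <;> fin_cases q <;> simp only [matchingRank, Fin.zero_eta, Fin.mk_one,
    Fin.reduceFinMk, Prod.mk.injEq, true_and] at h ⊢
  all_goals first
    | (exact yPlace_injective a (by omega))
    | (split_ifs at h <;> first
        | (exfalso; omega)
        | (apply Fin.ext; omega))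
    | (apply Fin.ext; omega)
    | (exfalso; omega)

/-- The recursion for the `y`-weights, inside a block. -/
theorem matchingWeight_y_succ {n : ℕ} (a : Composition n) (w₀ : ℝ≥0) (i j : Fin n)
    (hij : (j : ℕ) = i + 1) (h : a.index i = a.index j) :
    matchingWeight a w₀ (1, j) = matchingWeight a w₀ (1, i) + 1 := by
  have h₁ := a.sizeUpTo_index_le i
  have : yPlace a j = yPlace a i + 1 := by
    unfold yPlace
    rw [← h]
    omega
  simp only [matchingWeight, this]
  push_cast
  ring

/-- The recursion for the `y`-weights, from the last element `i` of a block to the first element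
`j` of the block before. -/
theorem matchingWeight_y_first {n : ℕ} (a : Composition n) (w₀ : ℝ≥0) (i j : Fin n)
    (hs : (a.index i : ℕ) = a.index j + 1)
    (hi : (i : ℕ) + 1 = a.sizeUpTo (a.index i + 1)) (hj : (j : ℕ) = a.sizeUpTo (a.index j)) :
    matchingWeight a w₀ (1, j) = matchingWeight a w₀ (1, i) + 1 := by
  have h₁ := a.sizeUpTo_index_le i
  have h₃ := a.sizeUpTo_le (a.index i + 1)
  have h₄ := i.2
  have : yPlace a j = yPlace a i + 1 := by
    unfold yPlace
    rw [← hs]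
    omega
  simp only [matchingWeight, this]
  push_cast
  ring

/-- The first element of the last block has `y`-weight `w₀ + 1`. -/
theorem matchingWeight_y_last {n : ℕ} (a : Composition n) (w₀ : ℝ≥0) (j : Fin n)
    (hs : (a.index j : ℕ) + 1 = a.length) (hj : (j : ℕ) = a.sizeUpTo (a.index j)) :
    matchingWeight a w₀ (1, j) = w₀ + 1 := by
  have : yPlace a j = 1 := by
    unfold yPlace
    rw [hs, a.sizeUpTo_length]
    omega
  simp only [matchingWeight, this]
  push_cast
  ring

/-- The weights of `z_3, …, z_n` in terms of the weight of `y_{α_1}`; here `j` is the last element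
of the first block, and the column `i` has the `1`-based number `i + 1`. -/
theorem matchingWeight_z {n : ℕ} (a : Composition n) (w₀ : ℝ≥0) (i j : Fin n) (hi : 2 ≤ (i : ℕ))
    (hs : (a.index j : ℕ) = 0) (hj : (j : ℕ) + 1 = a.sizeUpTo 1) :
    matchingWeight a w₀ (2, i) =
      matchingWeight a w₀ (1, j) + ((n - 2 : ℕ) : ℝ≥0) * ((i + 1 - 2 : ℕ) : ℝ≥0) := by
  have h₁ := j.2
  have : yPlace a j = n := by
    unfold yPlace
    rw [hs, zero_add, ← hj, a.sizeUpTo_zero]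
    omega
  simp only [matchingWeight, this, if_neg (not_lt.2 hi), Nat.cast_mul]

/-- The weight order of the block diagonal matching field of type `a`. -/
noncomputable def matchingOrder {n : ℕ} (a : Composition n) (w₀ : ℝ≥0) :
    MonomialOrder (Fin 3 × Fin n) :=
  weightRevLex (matchingWeight a w₀) (matchingRank a) (matchingRank_injective a)

/-!
The maximal minors of the generic `3 × n` matrix `X` are a Gröbner basis of the ideal `I` that they
generate for *every* monomial order, so only the leading monomials of the minors depend on the
weights. The argument is a count in each multidegree `u` for the grading by column degrees.

* Let `N u` be the set of monomials of multidegree `u` that are not divisible by a leading monomial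
  of a minor. Division by the minors shows that `N u` spans `(R ⧸ I)_u` (`monomialClass_mem_span`).
* The leading monomial of each minor is a product of one variable in each of its three columns. All
  sets of monomials that avoid one such product for every set of three columns have at most as many
  elements in multidegree `u` as the set `S u` obtained from the antidiagonal products `z_i y_j x_k`
  with `i < j < k` (`card_avoids_le`). The proof removes one column at a time; this requires the
  same statement for products over one, two and three columns.
* The monomials in `S u` are linearly independent modulo `I` (`linearIndepOn_isStaircase`). A
  combination in `I` vanishes at all matrices over integral domains whose rows satisfy a linear
  relation, and the vanishing of its coefficients follows by removing one column at a time
  (`coeff_eq_zero_of_isStaircase`). The first `m + 1` rows are taken to be dependent, with a nonzero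
  coefficient of row `m` (counted from `0`). If the exponent of the first column is zero in row `m`,
  this column can be taken generic outside row `m`; otherwise a matrix with `m` dependent rows is
  deformed into matrices with `m + 1` dependent rows such that the first column is generic with
  entry `1` in row `m`, and the coefficients of the deformation are compared.

Hence `#(N u) ≤ #(S u) ≤ dim (R ⧸ I)_u ≤ #(N u)`, so the monomials in `N u` are linearly independent
modulo `I`, and no element of `I` has its leading monomial in `N u`
(`exists_degree_maximalMinor_le`).

For the order of a block diagonal matching field the weights alone single out the matching monomial
of each minor (`yPlace_add_zPlace_lt`), so that it is the leading monomial.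
-/

/-! ### Exponent tables with prescribed column sums -/

/-- The exponent tables `e`, with `e j r` the exponent of the variable in row `r` and column `j`,
whose column sums are given by `u`. -/
def tables {n : ℕ} (u : Fin n → ℕ) : Finset (Fin n → Fin 3 → ℕ) :=
  Fintype.piFinset fun j => Finset.piAntidiag Finset.univ (u j)

theorem mem_tables {n : ℕ} {u : Fin n → ℕ} {e : Fin n → Fin 3 → ℕ} :
    e ∈ tables u ↔ ∀ j, ∑ r, e j r = u j := by
  simp [tables, Fintype.mem_piFinset]

theorem cons_mem_tables {n : ℕ} {u : Fin (n + 1) → ℕ} {x : Fin 3 → ℕ} {e : Fin n → Fin 3 → ℕ} :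
    (Fin.cons x e : Fin (n + 1) → Fin 3 → ℕ) ∈ tables u ↔
      x ∈ Finset.piAntidiag Finset.univ (u 0) ∧ e ∈ tables (Fin.tail u) := by
  simp [mem_tables, Fin.forall_fin_succ, Fin.tail]

theorem sum_tables_succ {M : Type*} [AddCommMonoid M] {n : ℕ} (u : Fin (n + 1) → ℕ)
    (f : (Fin (n + 1) → Fin 3 → ℕ) → M) :
    ∑ e ∈ tables u, f e =
      ∑ x ∈ Finset.piAntidiag Finset.univ (u 0), ∑ e ∈ tables (Fin.tail u), f (Fin.cons x e) := by
  rw [← Finset.sum_product']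
  refine Finset.sum_bij' (fun e _ => (e 0, Fin.tail e)) (fun p _ => Fin.cons p.1 p.2) ?_ ?_ ?_ ?_ ?_
  · intro e he
    rw [Finset.mem_product, ← cons_mem_tables, Fin.cons_self_tail]
    exact he
  · intro p hp
    rw [Finset.mem_product] at hp
    exact cons_mem_tables.2 hp
  · intro e _
    exact Fin.cons_self_tail e
  · intro p _
    simp
  · intro e _
    simp

/-- By symmetry, the number of columns of sum `k` with a zero in row `r` does not depend on `r`. -/
theorem card_filter_column_eq (k : ℕ) (r s : Fin 3) :
    ((Finset.piAntidiag Finset.univ k).filter fun x : Fin 3 → ℕ => x r = 0).card =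
      ((Finset.piAntidiag Finset.univ k).filter fun x : Fin 3 → ℕ => x s = 0).card := by
  refine Finset.card_bij' (fun x _ => x ∘ Equiv.swap r s) (fun x _ => x ∘ Equiv.swap r s)
    ?_ ?_ ?_ ?_
  · intro x hx
    simpa [Equiv.sum_comp (Equiv.swap r s) x] using hx
  · intro x hx
    simpa [Equiv.sum_comp (Equiv.swap r s) x] using hx
  · intro x _
    funext t
    simp
  · intro x _
    funext t
    simp

/-! ### Counting tables that avoid one monomial for each set of columns -/

/-- The table `e` is the exponent of a monomial that no product of `m` variables lying in rows
`m - 1, …, 1, 0` of columns `j₁ < ⋯ < jₘ`, in this order, divides: the first column with a nonzero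
entry in row `m - 1` is removed together with all columns before it, and the rest has the same
property for `m - 1`. Only `m ≤ 3` is meaningful: row numbers are taken modulo `3`. -/
def IsStaircase : (n m : ℕ) → (Fin n → Fin 3 → ℕ) → Prop
  | _, 0, _ => False
  | 0, _ + 1, _ => True
  | n + 1, m + 1, e =>
    if e 0 (Fin.ofNat 3 m) = 0 then IsStaircase n (m + 1) (Fin.tail e)
    else IsStaircase n m (Fin.tail e)

/-- For each set `S` of `m` columns, the monomial with exponent table `e` is not divisible by the
product of the variables in column `i` and row `ρ S i`, for `i ∈ S`. -/
def Avoids {n : ℕ} (m : ℕ) (ρ : Finset (Fin n) → Fin n → Fin 3) (e : Fin n → Fin 3 → ℕ) : Prop :=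
  ∀ S : Finset (Fin n), S.card = m → ∃ i ∈ S, e i (ρ S i) = 0

open Classical in
theorem card_isStaircase_succ {n : ℕ} (m : ℕ) (u : Fin (n + 1) → ℕ) :
    ((tables u).filter (IsStaircase (n + 1) (m + 1))).card =
      ((Finset.piAntidiag Finset.univ (u 0)).filter fun x : Fin 3 → ℕ => x 0 = 0).card *
          ((tables (Fin.tail u)).filter (IsStaircase n (m + 1))).card +
        ((Finset.piAntidiag Finset.univ (u 0)).filter fun x : Fin 3 → ℕ => x 0 ≠ 0).card *
          ((tables (Fin.tail u)).filter (IsStaircase n m)).card := by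
  have h0 := card_filter_column_eq (u 0) 0 (Fin.ofNat 3 m)
  have h1 := Finset.card_filter_add_card_filter_not (s := Finset.piAntidiag Finset.univ (u 0))
    (fun x : Fin 3 → ℕ => x 0 = 0)
  have h2 := Finset.card_filter_add_card_filter_not (s := Finset.piAntidiag Finset.univ (u 0))
    (fun x : Fin 3 → ℕ => x (Fin.ofNat 3 m) = 0)
  have h3 : ((Finset.piAntidiag Finset.univ (u 0)).filter fun x : Fin 3 → ℕ => x 0 ≠ 0).card =
      ((Finset.piAntidiag Finset.univ (u 0)).filter
        fun x : Fin 3 → ℕ => x (Fin.ofNat 3 m) ≠ 0).card := by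
    simp only [ne_eq]
    omega
  rw [h0, h3, Finset.card_filter, sum_tables_succ]
  simp only [IsStaircase, Fin.cons_zero, Fin.tail_cons]
  rw [← Finset.sum_filter_add_sum_filter_not _ (fun x : Fin 3 → ℕ => x (Fin.ofNat 3 m) = 0)]
  congr 1
  · rw [← smul_eq_mul, ← Finset.sum_const]
    refine Finset.sum_congr rfl fun x hx => ?_
    rw [Finset.card_filter]
    simp only [(Finset.mem_filter.1 hx).2, if_true]
  · rw [← smul_eq_mul, ← Finset.sum_const]
    refine Finset.sum_congr rfl fun x hx => ?_
    rw [Finset.card_filter]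
    simp only [if_neg (Finset.mem_filter.1 hx).2]

open Classical in
/-- Whatever monomials are avoided, there are at most as many tables as in the staircase case: if
`e` is obtained from `e'` by adding a first column `x`, then `e'` avoids the monomials of the sets
of `m + 1` of the remaining columns, and, unless `e'` also avoids the monomials obtained from sets
of `m` remaining columns, some entry of `x` has to be zero. -/
theorem card_avoids_le (n : ℕ) : ∀ (m : ℕ) (ρ : Finset (Fin n) → Fin n → Fin 3) (u : Fin n → ℕ),
    ((tables u).filter (Avoids m ρ)).card ≤ ((tables u).filter (IsStaircase n m)).card := by
  induction n with
  | zero =>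
    rintro (_ | m) ρ u
    · rw [Finset.filter_false_of_mem]
      · simp
      · intro e _ h
        obtain ⟨i, hi, -⟩ := h ∅ rfl
        simp at hi
    · exact Finset.card_le_card fun e he => by
        simp only [Finset.mem_filter] at he ⊢
        exact ⟨he.1, trivial⟩
  | succ n ih =>
    rintro (_ | m) ρ u
    · rw [Finset.filter_false_of_mem]
      · simp
      · intro e _ h
        obtain ⟨i, hi, -⟩ := h ∅ rfl
        simp at hi
    rw [card_isStaircase_succ]
    let ρ₁ : Finset (Fin n) → Fin n → Fin 3 := fun S i => ρ (S.map (Fin.succEmb n)) i.succ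
    let ext : Finset (Fin n) → Finset (Fin (n + 1)) := fun S =>
      Finset.cons 0 (S.map (Fin.succEmb n)) (by simp [Fin.succ_ne_zero])
    let ρ₀ : Finset (Fin n) → Fin n → Fin 3 := fun S i => ρ (ext S) i.succ
    refine le_trans ?_ (Nat.add_le_add (Nat.mul_le_mul_left _ (ih (m + 1) ρ₁ (Fin.tail u)))
      (Nat.mul_le_mul_left _ (ih m ρ₀ (Fin.tail u))))
    have h1 := Finset.card_filter_add_card_filter_not (s := Finset.piAntidiag Finset.univ (u 0))
      (fun x : Fin 3 → ℕ => x 0 = 0)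
    rw [Finset.card_filter, sum_tables_succ, Finset.sum_comm, Finset.card_filter (Avoids _ ρ₁),
      Finset.card_filter (Avoids _ ρ₀), Finset.mul_sum, Finset.mul_sum, ← Finset.sum_add_distrib]
    refine Finset.sum_le_sum fun e _ => ?_
    rw [← Finset.card_filter]
    by_cases hρ₁ : Avoids (m + 1) ρ₁ e
    · by_cases hρ₀ : Avoids m ρ₀ e
      · simp only [hρ₁, hρ₀, if_true, mul_one]
        refine (Finset.card_filter_le _ _).trans ?_
        exact h1.ge
      · simp only [hρ₁, hρ₀, if_true, if_false, mul_one, mul_zero, add_zero]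
        unfold Avoids at hρ₀
        push Not at hρ₀
        obtain ⟨S, hS, hne⟩ := hρ₀
        rw [card_filter_column_eq _ 0 (ρ (ext S) 0)]
        refine Finset.card_le_card fun x hx => ?_
        simp only [Finset.mem_filter] at hx ⊢
        refine ⟨hx.1, ?_⟩
        obtain ⟨i, hi, hi0⟩ := hx.2 (ext S) (by simp [ext, hS])
        simp only [ext, Finset.mem_cons, Finset.mem_map, Fin.coe_succEmb] at hi
        rcases hi with rfl | ⟨j, hj, rfl⟩
        · exact hi0
        · exact absurd hi0 (hne j hj)
    · rw [Finset.filter_false_of_mem]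
      · simp
      · intro x _ hx
        refine hρ₁ fun S hS => ?_
        obtain ⟨i, hi, hi0⟩ := hx (S.map (Fin.succEmb n)) (by simp [hS])
        simp only [Finset.mem_map, Fin.coe_succEmb] at hi
        obtain ⟨j, hj, rfl⟩ := hi
        exact ⟨j, hj, hi0⟩

/-! ### Points with dependent rows -/

/-- The points (matrices, given by their columns `P j`) whose first `m` rows satisfy a linear
relation in which the coefficient of row `m - 1` is nonzero; they are called points of level `m`.
There are none if `m = 0`. -/
def RowDependent {A : Type*} [CommRing A] {n : ℕ} (m : ℕ) (P : Fin n → Fin 3 → A) : Prop :=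
  ∃ r : Fin 3, (r : ℕ) + 1 = m ∧ ∃ w : Fin 3 → A,
    w r ≠ 0 ∧ (∀ s, r < s → w s = 0) ∧ ∀ j, ∑ s, w s * P j s = 0

/-- The value at the point `P` of the monomial with exponent table `e`. -/
def monomialValue {A : Type*} [CommRing A] {n : ℕ} (P : Fin n → Fin 3 → A)
    (e : Fin n → Fin 3 → ℕ) : A :=
  ∏ j, ∏ s, P j s ^ e j s

theorem monomialValue_cons {A : Type*} [CommRing A] {n : ℕ} (p : Fin 3 → A) (P : Fin n → Fin 3 → A)
    (x : Fin 3 → ℕ) (e : Fin n → Fin 3 → ℕ) :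
    monomialValue (Fin.cons p P : Fin (n + 1) → Fin 3 → A) (Fin.cons x e) =
      (∏ s, p s ^ x s) * monomialValue P e := by
  simp [monomialValue, Fin.prod_univ_succ (n := n)]

theorem map_monomialValue {A B : Type*} [CommRing A] [CommRing B] (f : A →+* B) {n : ℕ}
    (P : Fin n → Fin 3 → A) (e : Fin n → Fin 3 → ℕ) :
    f (monomialValue P e) = monomialValue (fun j s => f (P j s)) e := by
  simp [monomialValue]

/-- The value at `P` of the polynomial with coefficients `c` and column degrees `u`. -/
def tableSum {K A : Type*} [Field K] [CommRing A] [Algebra K A] {n : ℕ} (u : Fin n → ℕ)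
    (c : (Fin n → Fin 3 → ℕ) → K) (P : Fin n → Fin 3 → A) : A :=
  ∑ e ∈ tables u, algebraMap K A (c e) * monomialValue P e

theorem tableSum_cons {K A : Type*} [Field K] [CommRing A] [Algebra K A] {n : ℕ}
    (u : Fin (n + 1) → ℕ) (c : (Fin (n + 1) → Fin 3 → ℕ) → K) (p : Fin 3 → A)
    (P : Fin n → Fin 3 → A) :
    tableSum u c (Fin.cons p P) = ∑ x ∈ Finset.piAntidiag Finset.univ (u 0),
      (∏ s, p s ^ x s) * tableSum (Fin.tail u) (fun e => c (Fin.cons x e)) P := by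
  rw [tableSum, sum_tables_succ]
  refine Finset.sum_congr rfl fun x _ => ?_
  rw [tableSum, Finset.mul_sum]
  refine Finset.sum_congr rfl fun e _ => ?_
  rw [monomialValue_cons]
  ring

theorem map_tableSum {K A B : Type*} [Field K] [CommRing A] [CommRing B] [Algebra K A] [Algebra K B]
    (f : A →+* B) (hf : f.comp (algebraMap K A) = algebraMap K B) {n : ℕ} (u : Fin n → ℕ)
    (c : (Fin n → Fin 3 → ℕ) → K) (P : Fin n → Fin 3 → A) :
    f (tableSum u c P) = tableSum u c fun j s => f (P j s) := by
  simp only [tableSum, map_sum, map_mul, map_monomialValue, ← hf, RingHom.comp_apply]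

theorem tableSum_eq_zero_of_coeff {K A : Type*} [Field K] [CommRing A] [Algebra K A] {n : ℕ}
    {u : Fin n → ℕ} {c : (Fin n → Fin 3 → ℕ) → K} (h : ∀ e ∈ tables u, c e = 0)
    (P : Fin n → Fin 3 → A) : tableSum u c P = 0 :=
  Finset.sum_eq_zero fun e he => by rw [h e he, map_zero, zero_mul]

/-- A point `P` of level `r` is the value at `X = 0` of a family of points of level `r + 1` whose
additional first column is the generic column with entry `1` in row `r`: if `w` is the relation
between the rows of `P`, then `w - (∑ s, w s * X s) e_r` is the relation for the family. -/
theorem RowDependent.deformation {A : Type*} [CommRing A] [IsDomain A] {n : ℕ} {r : Fin 3}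
    {P : Fin n → Fin 3 → A} (hP : RowDependent r P) :
    RowDependent ((r : ℕ) + 1) (Fin.cons (fun s => if s = r then 1 else X s)
      (fun j s => C (P j s) + if s < r then C (P j r) * X s else 0) :
        Fin (n + 1) → Fin 3 → MvPolynomial (Fin 3) A) := by
  obtain ⟨t, ht, w, hwt, hw, hwP⟩ := hP
  have htr : t < r := by
    rw [Fin.lt_def]
    omega
  have hwr : ∀ s, r ≤ s → w s = 0 := fun s hs => hw s (htr.trans_le hs)
  refine ⟨r, rfl, fun s => C (w s) - if s = r then ∑ s, C (w s) * X s else 0, ?_, ?_, ?_⟩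
  · simp only [hwr r le_rfl, map_zero, if_true, zero_sub, ne_eq, neg_eq_zero]
    intro h
    apply hwt
    have := congrArg (coeff (Finsupp.single t 1)) h
    simpa [coeff_sum, coeff_C_mul, coeff_X, Finsupp.single_left_inj] using this
  · intro s hs
    simp [hwr s hs.le, hs.ne']
  · intro j
    refine Fin.cases ?_ (fun j => ?_) j
    · simp only [Fin.cons_zero, sub_mul, ite_mul, zero_mul, Finset.sum_sub_distrib,
        Finset.sum_ite_eq', Finset.mem_univ, if_true, mul_one]
      rw [sub_eq_zero]
      refine Finset.sum_congr rfl fun s _ => ?_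
      split_ifs with h
      · simp [h, hwr r le_rfl]
      · rfl
    · simp only [Fin.cons_succ, sub_mul, mul_add, ite_mul, zero_mul, Finset.sum_sub_distrib,
        Finset.sum_add_distrib, Finset.sum_ite_eq', Finset.mem_univ, if_true, lt_irrefl, if_false,
        mul_zero]
      have h1 : ∑ s, C (w s) * C (P j s) = (0 : MvPolynomial (Fin 3) A) := by
        simp only [← map_mul, ← map_sum, hwP j, map_zero]
      rw [h1, zero_sub, sub_zero, neg_add_eq_zero, Finset.sum_mul]
      refine Finset.sum_congr rfl fun s _ => ?_
      split_ifs with h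
      · ring
      · simp [hwr s (not_lt.1 h)]

/-- A point of level `r + 1` with relation `w` stays one when the column is added that has the
entries `w r * X s` in the rows `s ≠ r` and the entry forced by the relation in row `r`. -/
theorem RowDependent.generic_extension {A : Type*} [CommRing A] [IsDomain A] {n : ℕ} {r : Fin 3}
    {P : Fin n → Fin 3 → A} {w : Fin 3 → A} (hwr : w r ≠ 0) (hw : ∀ s, r < s → w s = 0)
    (hwP : ∀ j, ∑ s, w s * P j s = 0) :
    RowDependent ((r : ℕ) + 1) (Fin.cons
      (fun s => if s = r then -∑ s, (if s = r then 0 else C (w s) * X s) else C (w r) * X s)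
      (fun j s => C (P j s)) : Fin (n + 1) → Fin 3 → MvPolynomial (Fin 3) A) := by
  refine ⟨r, rfl, fun s => C (w s), by simpa using hwr, fun s hs => by simp [hw s hs], ?_⟩
  intro j
  refine Fin.cases ?_ (fun j => ?_) j
  · simp only [Fin.cons_zero]
    rw [← Finset.add_sum_erase _ _ (Finset.mem_univ r), if_pos rfl, mul_neg, neg_add_eq_zero,
      ← Finset.add_sum_erase (f := fun s => if s = r then (0 : MvPolynomial (Fin 3) A) else _) _
        (Finset.mem_univ r), if_pos rfl, zero_add, Finset.mul_sum]
    refine Finset.sum_congr rfl fun s hs => ?_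
    rw [if_neg (Finset.ne_of_mem_erase hs), if_neg (Finset.ne_of_mem_erase hs)]
    ring
  · simp only [Fin.cons_succ, ← map_mul, ← map_sum, hwP j, map_zero]

/-! ### Independence of the staircase monomials -/

/-- The polynomials of column degrees `u` supported on staircase monomials of level `m` that vanish
at all points of level `m` are zero. -/
theorem coeff_eq_zero_of_isStaircase.{v} {K : Type v} [Field K] (n : ℕ) :
    ∀ (m : ℕ), m ≤ 3 → ∀ (u : Fin n → ℕ) (c : (Fin n → Fin 3 → ℕ) → K),
      (∀ e, ¬ IsStaircase n m e → c e = 0) →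
      (∀ (A : Type v) [CommRing A] [IsDomain A] [Algebra K A] (P : Fin n → Fin 3 → A),
        RowDependent m P → tableSum u c P = 0) →
      ∀ e ∈ tables u, c e = 0 := by
  induction n with
  | zero =>
    rintro (_ | m) hm u c hc h e he
    · exact hc e id
    have hP : RowDependent (m + 1) (Fin.elim0 : Fin 0 → Fin 3 → K) :=
      ⟨⟨m, by omega⟩, rfl, Pi.single ⟨m, by omega⟩ 1, by simp,
        fun s hs => Pi.single_eq_of_ne hs.ne' _, fun j => j.elim0⟩
    have := h K _ hP
    rw [tableSum, Finset.sum_eq_single e] at this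
    · simpa [monomialValue] using this
    · exact fun e' _ hne => absurd (Subsingleton.elim _ _) hne
    · exact fun hne => absurd he hne
  | succ n ih =>
    rintro (_ | m) hm u c hc h
    · exact fun e _ => hc e id
    obtain ⟨r, rfl⟩ : ∃ r : Fin 3, m = (r : ℕ) := ⟨⟨m, by omega⟩, rfl⟩
    have hof : Fin.ofNat 3 (r : ℕ) = r := by simp
    set T := Finset.piAntidiag (Finset.univ : Finset (Fin 3)) (u 0) with hT
    have hsum : ∀ x ∈ T, ∑ s, x s = u 0 := fun x hx => by simpa [hT] using hx
    -- the exponent of the first column, without the entry in row `r`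
    let red : (Fin 3 → ℕ) → (Fin 3 →₀ ℕ) := fun x =>
      Finsupp.equivFunOnFinite.symm fun s => if s = r then 0 else x s
    have hred : ∀ x s, red x s = if s = r then 0 else x s := fun x s => rfl
    have hred_sum : ∀ x ∈ T, ∑ s, red x s + x r = u 0 := by
      intro x hx
      rw [← hsum x hx, ← Finset.add_sum_erase _ x (Finset.mem_univ r),
        ← Finset.add_sum_erase _ (red x) (Finset.mem_univ r), hred, if_pos rfl, zero_add, add_comm]
      congr 1
      exact Finset.sum_congr rfl fun s hs => by rw [hred, if_neg (Finset.ne_of_mem_erase hs)]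
    have hred_inj : ∀ x ∈ T, ∀ y ∈ T, red x = red y → x = y := by
      intro x hx y hy hxy
      have h1 := hred_sum x hx
      have h2 := hred_sum y hy
      rw [hxy] at h1
      funext s
      by_cases hs : s = r
      · rw [hs]
        omega
      · simpa [hred, hs] using DFunLike.congr_fun hxy s
    have hprod : ∀ (A : Type v) [CommRing A] (x : Fin 3 → ℕ),
        ∏ s, (if s = r then 1 else X s : MvPolynomial (Fin 3) A) ^ x s = monomial (red x) 1 := by
      intro A _ x
      rw [monomial_eq, C_1, one_mul, Finsupp.prod_fintype _ _ fun _ => pow_zero _]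
      refine Finset.prod_congr rfl fun s _ => ?_
      rw [hred]
      split_ifs <;> simp
    -- For exponents of the first column that are positive in row `r`, the coefficient of
    -- `X ^ red x` at the deformation is the value at `P` of the sum belonging to `x`, plus terms
    -- from `y` with `red y < red x`, which vanish by induction on the degree of `red x`.
    have key : ∀ (d : ℕ), ∀ x ∈ T, x r ≠ 0 → ∑ s, red x s = d →
        ∀ e ∈ tables (Fin.tail u), c (Fin.cons x e) = 0 := by
      intro d
      induction d using Nat.strong_induction_on with
      | _ d ihd =>
        intro x hx hxr hxd
        refine ih r (by omega) (Fin.tail u) (fun e => c (Fin.cons x e)) ?_ ?_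
        · intro e he
          refine hc _ fun h' => he ?_
          simpa only [IsStaircase, Fin.cons_zero, Fin.tail_cons, hof, hxr, if_false] using h'
        intro A _ _ _ P hP
        have h1 := congrArg (coeff (red x)) (h _ _ hP.deformation)
        rw [tableSum_cons, coeff_sum, coeff_zero, Finset.sum_eq_single x] at h1
        · rw [hprod, coeff_monomial_mul', if_pos le_rfl, tsub_self, one_mul, ← constantCoeff_eq,
            map_tableSum (A := MvPolynomial (Fin 3) A) (B := A) constantCoeff
              (RingHom.ext fun k => by
                rw [RingHom.comp_apply, MvPolynomial.algebraMap_apply, constantCoeff_C])] at h1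
          convert h1 using 1
          congr 1
          funext j s
          split_ifs <;> simp
        · intro y hy hyx
          rw [hprod, coeff_monomial_mul']
          split_ifs with hle
          · have hlt : ∑ s, red y s < d := by
              rw [← hxd]
              refine lt_of_le_of_ne (Finset.sum_le_sum fun s _ => hle s) fun heq => hyx ?_
              refine hred_inj y hy x hx (Finsupp.ext fun s => ?_)
              exact (Finset.sum_eq_sum_iff_of_le fun s _ => hle s).1 heq s (Finset.mem_univ s)
            have hyr : y r ≠ 0 := by
              have h2 := hred_sum x hx
              have h3 := hred_sum y hy
              omega
            rw [tableSum_eq_zero_of_coeff (ihd _ hlt y hy hyr rfl), coeff_zero, mul_zero]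
          · rfl
        · exact fun hx' => absurd hx hx'
    -- Exponents that are zero in row `r` remain; they are separated by the generic extension.
    intro e he
    rw [← Fin.cons_self_tail e] at he ⊢
    rw [cons_mem_tables] at he
    by_cases her : e 0 r = 0
    · set x := e 0 with hx
      refine ih (r + 1) hm (Fin.tail u) (fun e => c (Fin.cons x e)) ?_ ?_ _ he.2
      · intro e' he'
        refine hc _ fun h' => he' ?_
        simpa only [IsStaircase, Fin.cons_zero, Fin.tail_cons, hof, her, if_true] using h'
      rintro A _ _ _ P ⟨r', hr', w, hwr, hw, hwP⟩
      obtain rfl : r' = r := Fin.ext (by omega)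
      have h1 := congrArg (coeff (red x)) (h _ _ (RowDependent.generic_extension hwr hw hwP))
      have hC : ∀ c' : (Fin n → Fin 3 → ℕ) → K, tableSum (Fin.tail u) c'
          (fun j s => C (P j s) : Fin n → Fin 3 → MvPolynomial (Fin 3) A) =
            C (tableSum (Fin.tail u) c' P) := fun c' =>
        (map_tableSum C (RingHom.ext fun k => (MvPolynomial.algebraMap_apply k).symm) _ _ _).symm
      have hcol : ∀ y ∈ T, y r' = 0 → ∏ s, (if s = r' then
          -∑ s, (if s = r' then 0 else C (w s) * X s) else C (w r') * X s :
            MvPolynomial (Fin 3) A) ^ y s = monomial (red y) (w r' ^ u 0) := by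
        intro y hy hy0
        rw [monomial_eq, Finsupp.prod_fintype _ _ fun _ => pow_zero _, map_pow, ← hsum y hy,
          ← Finset.prod_pow_eq_pow_sum, ← Finset.prod_mul_distrib]
        refine Finset.prod_congr rfl fun s _ => ?_
        rw [hred]
        split_ifs with hs
        · simp [hs, hy0]
        · rw [mul_pow]
      rw [tableSum_cons, coeff_sum, coeff_zero, Finset.sum_eq_single x] at h1
      · rw [hC, hcol x he.1 her, mul_comm, coeff_C_mul, coeff_monomial, if_pos rfl] at h1
        exact (mul_eq_zero.1 h1).resolve_right (pow_ne_zero _ hwr)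
      · intro y hy hyx
        by_cases hyr : y r' = 0
        · rw [hC, hcol y hy hyr, mul_comm, coeff_C_mul, coeff_monomial,
            if_neg fun h' => hyx (hred_inj y hy x he.1 h'), mul_zero]
        · rw [tableSum_eq_zero_of_coeff (key _ y hy hyr rfl), mul_zero, coeff_zero]
      · exact fun hx' => absurd he.1 hx'
    · exact key _ _ he.1 her rfl _ he.2

/-! ### Maximal minors as sums of monomials -/

/-- The exponent of the monomial of the permutation `σ` in the maximal minor on the columns `c`. -/
noncomputable def minorExponent {n : ℕ} (σ : Equiv.Perm (Fin 3)) (c : Fin 3 ↪o Fin n) :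
    Fin 3 × Fin n →₀ ℕ :=
  ∑ q, Finsupp.single (σ q, c q) 1

theorem minorExponent_apply {n : ℕ} (σ : Equiv.Perm (Fin 3)) (c : Fin 3 ↪o Fin n) (p q : Fin 3) :
    minorExponent σ c (p, c q) = if σ q = p then 1 else 0 := by
  rw [minorExponent, Finsupp.finsetSum_apply, Finset.sum_eq_single q]
  · simp [Finsupp.single_apply]
  · intro q' _ hq
    rw [Finsupp.single_apply, if_neg]
    simp [hq]
  · simp

theorem minorExponent_injective {n : ℕ} (c : Fin 3 ↪o Fin n) :
    Function.Injective fun σ => minorExponent σ c := by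
  intro σ τ h
  ext q : 1
  have := DFunLike.congr_fun h (τ q, c q)
  simpa [minorExponent_apply] using this

theorem minorExponent_le {n : ℕ} {σ : Equiv.Perm (Fin 3)} {c : Fin 3 ↪o Fin n}
    {t : Fin 3 × Fin n →₀ ℕ} (h : ∀ q, t (σ q, c q) ≠ 0) : minorExponent σ c ≤ t := by
  rintro ⟨p, j⟩
  by_cases hj : ∃ q, c q = j
  · obtain ⟨q, rfl⟩ := hj
    rw [minorExponent_apply]
    split_ifs with hp
    · exact hp ▸ Nat.one_le_iff_ne_zero.2 (h q)
    · exact Nat.zero_le _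
  · push Not at hj
    rw [minorExponent, Finsupp.finsetSum_apply, Finset.sum_eq_zero]
    · exact Nat.zero_le _
    · intro q _
      rw [Finsupp.single_apply, if_neg]
      simp [hj q]

theorem maximalMinor_eq_sum (K : Type*) [Field K] {n : ℕ} (c : Fin 3 ↪o Fin n) :
    maximalMinor K c =
      ∑ σ : Equiv.Perm (Fin 3), monomial (minorExponent σ c) ((Equiv.Perm.sign σ : ℤ) : K) := by
  rw [maximalMinor, Matrix.det_apply']
  refine Finset.sum_congr rfl fun σ _ => ?_
  simp only [Matrix.submatrix_apply, id, Matrix.mvPolynomialX_apply, minorExponent]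
  rw [← mul_one ((Equiv.Perm.sign σ : ℤ) : K), ← C_mul_monomial, monomial_sum_one]
  simp [X]

theorem coeff_minorExponent (K : Type*) [Field K] {n : ℕ} (c : Fin 3 ↪o Fin n)
    (σ : Equiv.Perm (Fin 3)) :
    coeff (minorExponent σ c) (maximalMinor K c) = ((Equiv.Perm.sign σ : ℤ) : K) := by
  rw [maximalMinor_eq_sum, coeff_sum, Finset.sum_eq_single σ]
  · simp
  · intro τ _ hτ
    rw [coeff_monomial, if_neg fun h => hτ (minorExponent_injective c h)]
  · simp

theorem exists_of_mem_support_maximalMinor {K : Type*} [Field K] {n : ℕ} {c : Fin 3 ↪o Fin n}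
    {t : Fin 3 × Fin n →₀ ℕ} (ht : t ∈ (maximalMinor K c).support) :
    ∃ σ, t = minorExponent σ c := by
  by_contra! h
  rw [mem_support_iff, maximalMinor_eq_sum, coeff_sum] at ht
  exact ht (Finset.sum_eq_zero fun σ _ => by rw [coeff_monomial, if_neg (h σ).symm])

theorem cast_permSign_ne_zero (K : Type*) [Field K] (σ : Equiv.Perm (Fin 3)) :
    ((Equiv.Perm.sign σ : ℤ) : K) ≠ 0 := by
  rcases Int.units_eq_one_or (Equiv.Perm.sign σ) with h | h <;> simp [h]

theorem minorExponent_mem_support (K : Type*) [Field K] {n : ℕ} (c : Fin 3 ↪o Fin n)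
    (σ : Equiv.Perm (Fin 3)) : minorExponent σ c ∈ (maximalMinor K c).support := by
  rw [mem_support_iff, coeff_minorExponent]
  exact cast_permSign_ne_zero K σ

theorem maximalMinor_ne_zero (K : Type*) [Field K] {n : ℕ} (c : Fin 3 ↪o Fin n) :
    maximalMinor K c ≠ 0 := by
  rw [← support_nonempty]
  exact ⟨_, minorExponent_mem_support K c 1⟩

/-- At a point whose rows are linearly dependent all maximal minors vanish. -/
theorem aeval_eq_zero_of_mem_minorIdeal {K A : Type*} [Field K] [CommRing A] [IsDomain A]
    [Algebra K A] {n : ℕ} {P : Fin n → Fin 3 → A} (hP : RowDependent 3 P)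
    {f : MvPolynomial (Fin 3 × Fin n) K} (hf : f ∈ minorIdeal K n) :
    aeval (fun v : Fin 3 × Fin n => P v.2 v.1) f = 0 := by
  obtain ⟨r, -, w, hwr, -, hwP⟩ := hP
  suffices minorIdeal K n ≤ RingHom.ker (aeval (R := K) fun v : Fin 3 × Fin n => P v.2 v.1) from
    RingHom.mem_ker.1 (this hf)
  rw [minorIdeal, Ideal.span_le]
  rintro _ ⟨c, rfl⟩
  rw [SetLike.mem_coe, RingHom.mem_ker]
  simp only [maximalMinor]
  rw [AlgHom.map_det]
  refine Matrix.exists_vecMul_eq_zero_iff.1 ⟨w, fun h => hwr (congrFun h r), ?_⟩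
  funext q
  simpa [Matrix.vecMul, dotProduct] using hwP (c q)

/-! ### The grading by column degrees -/

/-- The weight for the grading of the polynomial ring by the degrees in each column. -/
def columnWeight {n : ℕ} (v : Fin 3 × Fin n) : Fin n → ℕ :=
  Pi.single v.2 1

theorem weight_columnWeight_apply {n : ℕ} (t : Fin 3 × Fin n →₀ ℕ) (j : Fin n) :
    Finsupp.weight columnWeight t j = ∑ r, t (r, j) := by
  rw [Finsupp.weight_apply, Finsupp.sum_fintype _ _ (by simp), Finset.sum_apply,
    Fintype.sum_prod_type]
  refine Finset.sum_congr rfl fun r _ => ?_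
  rw [Finset.sum_eq_single j]
  · simp [columnWeight]
  · intro i _ hi
    simp [columnWeight, hi.symm]
  · simp

theorem weight_minorExponent {n : ℕ} (σ : Equiv.Perm (Fin 3)) (c : Fin 3 ↪o Fin n) :
    Finsupp.weight columnWeight (minorExponent σ c) = ∑ q, Pi.single (c q) 1 := by
  simp [minorExponent, columnWeight, Finsupp.weight_single]

theorem weightedHomogeneousComponent_mem_minorIdeal {K : Type*} [Field K] {n : ℕ}
    {f : MvPolynomial (Fin 3 × Fin n) K} (hf : f ∈ minorIdeal K n) (u : Fin n → ℕ) :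
    weightedHomogeneousComponent columnWeight u f ∈ minorIdeal K n := by
  let _ := weightedGradedAlgebra K (columnWeight (n := n))
  have hom : (minorIdeal K n).IsHomogeneous (weightedHomogeneousSubmodule K columnWeight) := by
    refine Ideal.homogeneous_span _ _ ?_
    rintro _ ⟨c, rfl⟩
    refine ⟨∑ q, Pi.single (c q) 1, (mem_weightedHomogeneousSubmodule _ _ _ _).2 ?_⟩
    intro t ht
    obtain ⟨σ, rfl⟩ := exists_of_mem_support_maximalMinor (mem_support_iff.2 ht)
    exact weight_minorExponent σ c
  rw [← weightedDecomposition.decompose'_apply]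
  exact hom u hf

/-! ### The maximal minors are a Gröbner basis for every monomial order -/

/-- The monomial with exponent `t` is not divisible by the leading monomial of a maximal minor. -/
def IsReducedExponent (K : Type*) [Field K] {n : ℕ} (m : MonomialOrder (Fin 3 × Fin n))
    (t : Fin 3 × Fin n →₀ ℕ) : Prop :=
  ∀ c : Fin 3 ↪o Fin n, ¬ m.degree (maximalMinor K c) ≤ t

/-- The class of a monomial modulo the ideal of maximal minors. -/
noncomputable def monomialClass (K : Type*) [Field K] {n : ℕ} (t : Fin 3 × Fin n →₀ ℕ) :
    MvPolynomial (Fin 3 × Fin n) K ⧸ minorIdeal K n :=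
  Ideal.Quotient.mkₐ K (minorIdeal K n) (monomial t 1)

/-- Division by the maximal minors. It preserves the column degree because the minors are
homogeneous. -/
theorem monomialClass_mem_span {K : Type*} [Field K] {n : ℕ} (m : MonomialOrder (Fin 3 × Fin n))
    (s : Fin 3 × Fin n →₀ ℕ) :
    monomialClass K s ∈ Submodule.span K (monomialClass K '' {t | IsReducedExponent K m t ∧
      Finsupp.weight columnWeight t = Finsupp.weight columnWeight s ∧ t ≼[m] s}) := by
  obtain ⟨a, ha⟩ : ∃ a, a = m.toSyn s := ⟨_, rfl⟩
  induction a using WellFoundedLT.induction generalizing s with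
  | _ a ih =>
    by_cases hs : IsReducedExponent K m s
    · exact Submodule.subset_span ⟨s, ⟨hs, rfl, le_rfl⟩, rfl⟩
    unfold IsReducedExponent at hs
    push Not at hs
    obtain ⟨c, hc⟩ := hs
    obtain ⟨σ, hσ⟩ := exists_of_mem_support_maximalMinor
      (m.degree_mem_support (maximalMinor_ne_zero K c))
    obtain ⟨d, rfl⟩ := exists_add_of_le hc
    -- the relation given by the multiple of the minor with leading exponent `s`
    have hrel : ∑ τ : Equiv.Perm (Fin 3),
        ((Equiv.Perm.sign τ : ℤ) : K) • monomialClass K (minorExponent τ c + d) = 0 := by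
      have h : maximalMinor K c * monomial d 1 ∈ minorIdeal K n :=
        Ideal.mul_mem_right _ _ (Ideal.subset_span ⟨c, rfl⟩)
      rw [← Ideal.Quotient.eq_zero_iff_mem, ← Ideal.Quotient.mkₐ_eq_mk K, maximalMinor_eq_sum,
        Finset.sum_mul, map_sum] at h
      rw [← h]
      refine Finset.sum_congr rfl fun τ _ => ?_
      rw [monomialClass, ← map_smul, smul_monomial, monomial_mul, smul_eq_mul]
    rw [← Finset.add_sum_erase _ _ (Finset.mem_univ σ), ← hσ] at hrel
    rw [← Submodule.smul_mem_iff _ (cast_permSign_ne_zero K σ), eq_neg_of_add_eq_zero_left hrel]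
    refine Submodule.neg_mem _ (Submodule.sum_mem _ fun τ hτ => Submodule.smul_mem _ _ ?_)
    have hlt : minorExponent τ c + d ≺[m] m.degree (maximalMinor K c) + d := by
      rw [map_add, map_add]
      refine add_lt_add_left (lt_of_le_of_ne (m.le_degree (minorExponent_mem_support K c τ)) ?_) _
      intro h
      exact Finset.ne_of_mem_erase hτ (minorExponent_injective c ((m.toSyn.injective h).trans hσ))
    refine Submodule.span_mono (Set.image_mono ?_) (ih _ (ha ▸ hlt) _ rfl)
    rintro t ⟨h1, h2, h3⟩
    refine ⟨h1, ?_, h3.trans hlt.le⟩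
    rw [h2, map_add, map_add, hσ, weight_minorExponent, weight_minorExponent]

/-- The exponent vector of a table. -/
noncomputable def tableExponent {n : ℕ} (e : Fin n → Fin 3 → ℕ) : Fin 3 × Fin n →₀ ℕ :=
  Finsupp.equivFunOnFinite.symm fun v => e v.2 v.1

@[simp]
theorem tableExponent_apply {n : ℕ} (e : Fin n → Fin 3 → ℕ) (v : Fin 3 × Fin n) :
    tableExponent e v = e v.2 v.1 := rfl

theorem tableExponent_coe {n : ℕ} (t : Fin 3 × Fin n →₀ ℕ) :
    tableExponent (fun j r => t (r, j)) = t :=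
  Finsupp.ext fun _ => rfl

theorem mem_tables_iff_weight {n : ℕ} {u : Fin n → ℕ} {e : Fin n → Fin 3 → ℕ} :
    e ∈ tables u ↔ Finsupp.weight columnWeight (tableExponent e) = u := by
  simp [mem_tables, funext_iff, weight_columnWeight_apply]

open Classical in
theorem linearIndepOn_isStaircase (K : Type*) [Field K] {n : ℕ} (u : Fin n → ℕ) :
    LinearIndepOn K (fun e => monomialClass K (tableExponent e))
      ((tables u).filter (IsStaircase n 3) : Set (Fin n → Fin 3 → ℕ)) := by
  rw [linearIndepOn_finset_iff]
  intro f hf e he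
  rw [Finset.mem_filter] at he
  have := coeff_eq_zero_of_isStaircase n 3 le_rfl u (fun e => if IsStaircase n 3 e then f e else 0)
    (fun e he => if_neg he) ?_ e he.1
  · rwa [if_pos he.2] at this
  intro A _ _ _ P hP
  replace hf : Ideal.Quotient.mkₐ K (minorIdeal K n)
      (∑ e ∈ (tables u).filter (IsStaircase n 3), f e • monomial (tableExponent e) 1) = 0 := by
    simpa only [map_sum, map_smul, monomialClass] using hf
  rw [Ideal.Quotient.mkₐ_eq_mk, Ideal.Quotient.eq_zero_iff_mem] at hf
  rw [← aeval_eq_zero_of_mem_minorIdeal hP hf, map_sum, Finset.sum_filter, tableSum]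
  refine Finset.sum_congr rfl fun e _ => ?_
  split_ifs
  · rw [map_smul, aeval_monomial, map_one, one_mul, Algebra.smul_def,
      Finsupp.prod_fintype _ _ fun _ => pow_zero _, Fintype.prod_prod_type_right]
    rfl
  · simp

open Classical in
/-- Each leading monomial is the product of one variable in each of three columns, so the reduced
monomials avoid such products. -/
theorem card_isReducedExponent_le {K : Type*} [Field K] {n : ℕ} (m : MonomialOrder (Fin 3 × Fin n))
    (u : Fin n → ℕ) : ((tables u).filter fun e => IsReducedExponent K m (tableExponent e)).card ≤
      ((tables u).filter (IsStaircase n 3)).card := by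
  choose σ hσ using fun c : Fin 3 ↪o Fin n => exists_of_mem_support_maximalMinor
    (m.degree_mem_support (maximalMinor_ne_zero K c))
  let ρ : Finset (Fin n) → Fin n → Fin 3 := fun S =>
    if hS : S.card = 3 then Function.extend (S.orderEmbOfFin hS) (σ (S.orderEmbOfFin hS)) 0 else 0
  refine le_trans (Finset.card_le_card fun e he => ?_) (card_avoids_le n 3 ρ u)
  rw [Finset.mem_filter] at he ⊢
  refine ⟨he.1, fun S hS => ?_⟩
  by_contra! h
  refine he.2 (S.orderEmbOfFin hS) (hσ (S.orderEmbOfFin hS) ▸ minorExponent_le fun q => ?_)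
  have := h _ (S.orderEmbOfFin_mem hS q)
  simpa [ρ, hS, (S.orderEmbOfFin hS).injective.extend_apply] using this

open Classical in
/-- The reduced monomials of column degree `u` span a space that contains the classes of the
staircase monomials, and they are at most as many; so they are linearly independent as well. -/
theorem linearIndepOn_isReducedExponent (K : Type*) [Field K] {n : ℕ}
    (m : MonomialOrder (Fin 3 × Fin n)) (u : Fin n → ℕ) :
    LinearIndepOn K (fun e => monomialClass K (tableExponent e))
      ((tables u).filter fun e => IsReducedExponent K m (tableExponent e) :
        Set (Fin n → Fin 3 → ℕ)) := by
  set S := (tables u).filter (IsStaircase n 3)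
  set N := (tables u).filter fun e => IsReducedExponent K m (tableExponent e)
  have hS : LinearIndependent K fun e : S => monomialClass K (tableExponent e.1) :=
    linearIndepOn_isStaircase K u
  change LinearIndependent K fun e : N => monomialClass K (tableExponent e.1)
  rw [linearIndependent_iff_card_le_finrank_span, Fintype.card_coe]
  refine (card_isReducedExponent_le m u).trans ?_
  rw [← Fintype.card_coe, ← finrank_span_eq_card hS]
  have := FiniteDimensional.span_of_finite K
    (Set.finite_range fun e : N => monomialClass K (tableExponent e.1))
  refine Submodule.finrank_mono (Submodule.span_le.2 ?_)
  rintro _ ⟨e, rfl⟩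
  refine Submodule.span_mono ?_ (monomialClass_mem_span m _)
  rintro _ ⟨t, ⟨h1, h2, -⟩, rfl⟩
  refine ⟨⟨fun j r => t (r, j), ?_⟩, congrArg (monomialClass K) (tableExponent_coe t)⟩
  rw [Finset.mem_filter, mem_tables_iff_weight, tableExponent_coe, h2, ← mem_tables_iff_weight]
  exact ⟨(Finset.mem_filter.1 e.2).1, h1⟩

/-- The leading monomial of a nonzero element of the ideal of maximal minors is divisible by the
leading monomial of a maximal minor, for every monomial order. -/
theorem exists_degree_maximalMinor_le {K : Type*} [Field K] {n : ℕ}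
    (m : MonomialOrder (Fin 3 × Fin n)) {f : MvPolynomial (Fin 3 × Fin n) K}
    (hf : f ∈ minorIdeal K n) (hf0 : f ≠ 0) :
    ∃ c : Fin 3 ↪o Fin n, m.degree (maximalMinor K c) ≤ m.degree f := by
  classical
  by_contra! hred
  set d := m.degree f
  set u := Finsupp.weight columnWeight d
  set g := weightedHomogeneousComponent columnWeight u f with hg
  have hgI : ∑ t ∈ g.support, coeff t g • monomialClass K t = 0 := by
    have h := weightedHomogeneousComponent_mem_minorIdeal hf u
    rw [← hg, ← Ideal.Quotient.eq_zero_iff_mem, ← Ideal.Quotient.mkₐ_eq_mk K, g.as_sum,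
      map_sum] at h
    rw [← h]
    refine Finset.sum_congr rfl fun t _ => ?_
    rw [monomialClass, ← map_smul, smul_monomial, smul_eq_mul, mul_one]
  have hgc : ∀ t ∈ g.support, Finsupp.weight columnWeight t = u ∧ t ∈ f.support := by
    intro t ht
    rw [hg, support_weightedHomogeneousComponent, Finset.mem_filter] at ht
    exact ⟨ht.2, ht.1⟩
  have hd : d ∈ g.support := by
    rw [hg, support_weightedHomogeneousComponent, Finset.mem_filter]
    exact ⟨m.degree_mem_support hf0, rfl⟩
  -- the class of the leading monomial is a combination of classes of smaller reduced monomials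
  have hmem : monomialClass K d ∈ Submodule.span K (monomialClass K ''
      {t | IsReducedExponent K m t ∧ Finsupp.weight columnWeight t = u ∧ t ≺[m] d}) := by
    rw [← Finset.add_sum_erase _ _ hd] at hgI
    rw [← Submodule.smul_mem_iff _ (mem_support_iff.1 hd), eq_neg_of_add_eq_zero_left hgI]
    refine Submodule.neg_mem _ (Submodule.sum_mem _ fun t ht => Submodule.smul_mem _ _ ?_)
    obtain ⟨htd, ht⟩ := Finset.mem_erase.1 ht
    refine Submodule.span_mono (Set.image_mono ?_) (monomialClass_mem_span m t)
    rintro s ⟨h1, h2, h3⟩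
    refine ⟨h1, h2.trans (hgc t ht).1, h3.trans_lt ?_⟩
    exact lt_of_le_of_ne (m.le_degree (hgc t ht).2) fun h => htd (m.toSyn.injective h)
  have hind := linearIndepOn_isReducedExponent K m u
  let e₀ : ((tables u).filter fun e => IsReducedExponent K m (tableExponent e) :
      Set (Fin n → Fin 3 → ℕ)) := ⟨fun j r => d (r, j), by
    rw [Finset.mem_coe, Finset.mem_filter, mem_tables_iff_weight, tableExponent_coe]
    exact ⟨rfl, hred⟩⟩
  refine hind.notMem_span_image (s := {e₀}ᶜ) (x := e₀) (by simp) ?_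
  change monomialClass K (tableExponent fun j r => d (r, j)) ∈ _
  rw [tableExponent_coe]
  refine Submodule.span_mono ?_ hmem
  rintro _ ⟨t, ⟨h1, h2, h3⟩, rfl⟩
  refine ⟨⟨fun j r => t (r, j), ?_⟩, ?_, congrArg (monomialClass K) (tableExponent_coe t)⟩
  · rw [Finset.mem_coe, Finset.mem_filter, mem_tables_iff_weight, tableExponent_coe]
    exact ⟨h2, h1⟩
  · intro h
    have h4 := congrArg (fun e => tableExponent e.1) (Set.mem_singleton_iff.1 h)
    simp only [e₀, tableExponent_coe] at h4
    exact h3.ne (congrArg m.toSyn h4)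

/-! ### Leading monomials for the order of a block diagonal matching field -/

theorem Composition.index_mono {n : ℕ} (a : Composition n) : Monotone a.index := by
  intro i j hij
  by_contra! h
  have h₁ := a.sizeUpTo_index_le i
  have h₂ := a.lt_sizeUpTo_index_succ j
  have h₃ : a.sizeUpTo (a.index j + 1) ≤ a.sizeUpTo (a.index i) :=
    a.monotone_sizeUpTo (Nat.succ_le_of_lt h)
  simp only [Fin.val_succ] at h₂
  rw [Fin.le_def] at hij
  omega

/-- The place in the order of the `y`-variables grows by `1` inside a block and drops from one
block to the next. -/
theorem yPlace_le_add {n : ℕ} (a : Composition n) {i j : Fin n} (hij : i ≤ j) :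
    yPlace a j ≤ yPlace a i + (j - i : ℕ) := by
  rcases (a.index_mono hij).lt_or_eq with h | h
  · exact ((yPlace_lt_iff a j i).2 (Or.inl h)).le.trans (Nat.le_add_right _ _)
  · have h₁ := a.sizeUpTo_index_le i
    have h₂ := a.sizeUpTo_index_le j
    rw [Fin.le_def] at hij
    unfold yPlace
    rw [← h] at h₂ ⊢
    omega

/-- The permutation whose monomial in the maximal minor on `c` is the matching monomial. -/
def matchingPerm {n : ℕ} (a : Composition n) (c : Fin 3 ↪o Fin n) : Equiv.Perm (Fin 3) :=
  if a.index (c 0) < a.index (c 1) then Equiv.swap 0 1 else 1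

theorem firstBlock_eq {n : ℕ} (a : Composition n) (c : Fin 3 ↪o Fin n) :
    firstBlock a c = a.index (c 0) := by
  refine le_antisymm (Finset.inf'_le _ (Finset.mem_univ 0)) (Finset.le_inf' _ _ fun p _ => ?_)
  exact a.index_mono (c.monotone (Fin.zero_le p))

theorem card_filter_firstBlock_eq_one_iff {n : ℕ} (a : Composition n) (c : Fin 3 ↪o Fin n) :
    (Finset.univ.filter fun p => a.index (c p) = firstBlock a c).card = 1 ↔
      a.index (c 0) < a.index (c 1) := by
  rw [firstBlock_eq]
  have h01 : a.index (c 0) ≤ a.index (c 1) := a.index_mono (c.monotone (by decide))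
  have h12 : a.index (c 1) ≤ a.index (c 2) := a.index_mono (c.monotone (by decide))
  constructor
  · intro h
    refine lt_of_le_of_ne h01 fun h' => ?_
    obtain ⟨p, hp⟩ := Finset.card_eq_one.1 h
    have h0 : (0 : Fin 3) ∈ ({p} : Finset (Fin 3)) := hp ▸ by simp
    have h1 : (1 : Fin 3) ∈ ({p} : Finset (Fin 3)) := hp ▸ by simp [h']
    rw [Finset.mem_singleton] at h0 h1
    exact absurd (h0.trans h1.symm) (by decide)
  · intro h
    rw [Finset.card_eq_one]
    refine ⟨0, ?_⟩
    ext p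
    fin_cases p
    · simp
    · simpa using h.ne'
    · simpa using (h.trans_le h12).ne'

theorem matchingMonomial_eq (K : Type*) [Field K] {n : ℕ} (a : Composition n)
    (c : Fin 3 ↪o Fin n) :
    matchingMonomial K a c = monomial (minorExponent (matchingPerm a c) c) 1 := by
  simp only [matchingMonomial, card_filter_firstBlock_eq_one_iff, matchingPerm, minorExponent]
  rw [monomial_sum_one, Fin.prod_univ_three]
  split_ifs
  · rw [show Equiv.swap (0 : Fin 3) 1 2 = 2 by decide, Equiv.swap_apply_left,
      Equiv.swap_apply_right, mul_comm (X (0, c 1))]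
    rfl
  · rfl

/-- The excess of the weight of the variable `z_i` over `w₀`. -/
def zPlace (n i : ℕ) : ℕ :=
  if i < 2 then 0 else n + (n - 2) * (i + 1 - 2)

theorem weight_minorExponent_matchingWeight {n : ℕ} (a : Composition n) (w₀ : ℝ≥0)
    (σ : Equiv.Perm (Fin 3)) (c : Fin 3 ↪o Fin n) :
    Finsupp.weight (matchingWeight a w₀) (minorExponent σ c) =
      3 * w₀ + (yPlace a (c (σ.symm 1)) + zPlace n (c (σ.symm 2)) : ℕ) := by
  have h : Finsupp.weight (matchingWeight a w₀) (minorExponent σ c) =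
      ∑ p, matchingWeight a w₀ (p, c (σ.symm p)) := by
    rw [minorExponent, map_sum, ← Equiv.sum_comp σ fun p => matchingWeight a w₀ (p, c (σ.symm p))]
    simp [Finsupp.weight_single]
  rw [h, Fin.sum_univ_three]
  simp only [matchingWeight, zPlace]
  split_ifs <;> push_cast <;> ring

/-- Moving the `z`-variable from column `k` to a smaller column loses at least `n - 2 ≥ 2` times
the distance of the columns, or all its excess weight if the new column is one of the first two. -/
theorem add_zPlace_lt {n i k y y' : ℕ} (hik : i < k) (hk : 2 ≤ k) (hkn : k < n) (hy : y ≤ n)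
    (hy' : 0 < y') (h : y ≤ y' + (k - i)) : y + zPlace n i < y' + zPlace n k := by
  unfold zPlace
  rw [if_neg (not_lt.2 hk)]
  split_ifs with hi
  · exact lt_of_lt_of_le (by omega) (Nat.add_le_add_left (Nat.le_add_right n _) _)
  · obtain ⟨d, rfl⟩ := Nat.exists_eq_add_of_lt hik
    have h1 : i + d + 1 + 1 - 2 = (i + 1 - 2) + (d + 1) := by omega
    have h2 : 2 * (d + 1) ≤ (n - 2) * (d + 1) := Nat.mul_le_mul_right _ (by omega)
    rw [h1, mul_add]
    omega

theorem perm_fin_three_ext {σ τ : Equiv.Perm (Fin 3)} (h1 : σ 1 = τ 1) (h2 : σ 2 = τ 2) :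
    σ = τ := by
  revert σ τ
  decide

/-- The weight of the matching monomial is the largest among the monomials of the minor. The
largest column has to carry the `z`-variable: moving it to a smaller column loses more than is
gained by moving the `y`-variable, since its weight grows at most by the distance of the columns.
The first two columns then compete for the `y`-variable. -/
theorem yPlace_add_zPlace_lt {n : ℕ} (a : Composition n) (c : Fin 3 ↪o Fin n)
    {σ : Equiv.Perm (Fin 3)} (hσ : σ ≠ matchingPerm a c) :
    yPlace a (c (σ.symm 1)) + zPlace n (c (σ.symm 2)) <
      yPlace a (c ((matchingPerm a c).symm 1)) + zPlace n (c ((matchingPerm a c).symm 2)) := by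
  have hc01 : c 0 < c 1 := c.strictMono (by decide)
  have hc12 : c 1 < c 2 := c.strictMono (by decide)
  have hy10 := yPlace_le_add a hc01.le
  have hy20 := yPlace_le_add a (hc01.trans hc12).le
  have hy21 := yPlace_le_add a hc12.le
  have hz2 : (matchingPerm a c).symm 2 = 2 := by
    unfold matchingPerm
    split_ifs <;> decide
  -- the matching permutation selects the larger of the first two `y`-variables
  have hmax : ∀ j : Fin 3, j ≠ 2 → j ≠ (matchingPerm a c).symm 1 →
      yPlace a (c j) < yPlace a (c ((matchingPerm a c).symm 1)) := by
    unfold matchingPerm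
    split_ifs with h
    · intro j
      fin_cases j
      · simp
      · intro _ _
        simpa using (yPlace_lt_iff a (c 1) (c 0)).2 (Or.inl h)
      · simp
    · have h' := le_antisymm (a.index_mono hc01.le) (not_lt.1 h)
      rw [show (1 : Equiv.Perm (Fin 3)).symm 1 = 1 from rfl]
      intro j
      fin_cases j
      · intro _ _
        simpa using (yPlace_lt_iff a (c 0) (c 1)).2 (Or.inr ⟨h'.symm, hc01⟩)
      · simp
      · simp
  have hle : ∀ j : Fin 3, j ≠ 2 →
      yPlace a (c j) ≤ yPlace a (c ((matchingPerm a c).symm 1)) := by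
    intro j hj
    by_cases h : j = (matchingPerm a c).symm 1
    · rw [h]
    · exact (hmax j hj h).le
  have h0 := hle 0 (by decide)
  have h1 := hle 1 (by decide)
  have hpos := yPlace_pos a (c ((matchingPerm a c).symm 1))
  have hne : σ.symm 1 ≠ σ.symm 2 := σ.symm.injective.ne (by decide)
  have hext : σ.symm 1 = (matchingPerm a c).symm 1 → σ.symm 2 ≠ 2 := by
    intro h1 h2
    exact hσ (Equiv.symm_bijective.injective (perm_fin_three_ext h1 (h2.trans hz2.symm)))
  rw [hz2]
  generalize (matchingPerm a c).symm 1 = j₀ at *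
  generalize σ.symm 1 = j at *
  generalize σ.symm 2 = k at *
  have hn := (c 2).2
  have hyn := fun i => yPlace_le a (c i)
  rw [Fin.lt_def] at hc01 hc12
  fin_cases k
  · refine add_zPlace_lt (hc01.trans hc12) (by omega) hn (hyn j) hpos ?_
    fin_cases j
    · exact absurd rfl hne
    · exact h1.trans (Nat.le_add_right _ _)
    · exact hy20.trans (Nat.add_le_add_right h0 _)
  · refine add_zPlace_lt hc12 (by omega) hn (hyn j) hpos ?_
    fin_cases j
    · exact h0.trans (Nat.le_add_right _ _)
    · exact absurd rfl hne
    · exact hy21.trans (Nat.add_le_add_right h1 _)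
  · exact Nat.add_lt_add_right (hmax j hne fun h => hext h rfl) _

theorem degree_maximalMinor (K : Type*) [Field K] {n : ℕ} (a : Composition n) (w₀ : ℝ≥0)
    (c : Fin 3 ↪o Fin n) :
    (matchingOrder a w₀).degree (maximalMinor K c) = minorExponent (matchingPerm a c) c := by
  obtain ⟨σ, hσ⟩ := exists_of_mem_support_maximalMinor
    ((matchingOrder a w₀).degree_mem_support (maximalMinor_ne_zero K c))
  rw [hσ]
  by_contra hne
  have hσ' : σ ≠ matchingPerm a c := fun h => hne (by rw [h])
  have hle := (matchingOrder a w₀).le_degree (minorExponent_mem_support K c (matchingPerm a c))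
  rw [hσ] at hle
  refine hle.not_gt ((weightRevLex_lt_iff _ _ _ _ _).2 (Or.inl ?_))
  rw [weight_minorExponent_matchingWeight, weight_minorExponent_matchingWeight]
  have := yPlace_add_zPlace_lt a c hσ'
  gcongr

theorem leadingTerm_maximalMinor (K : Type*) [Field K] {n : ℕ} (a : Composition n)
    (w₀ : ℝ≥0) (c : Fin 3 ↪o Fin n) :
    (matchingOrder a w₀).leadingTerm (maximalMinor K c) =
      C ((Equiv.Perm.sign (matchingPerm a c) : ℤ) : K) * matchingMonomial K a c := by
  rw [MonomialOrder.leadingTerm, MonomialOrder.leadingCoeff, degree_maximalMinor,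
    coeff_minorExponent, matchingMonomial_eq, C_mul_monomial, mul_one]

theorem span_leadingTerm_maximalMinor (K : Type*) [Field K] {n : ℕ} (a : Composition n)
    (w₀ : ℝ≥0) :
    Ideal.span ((matchingOrder a w₀).leadingTerm ''
      Set.range fun c : Fin 3 ↪o Fin n => maximalMinor K c) = matchingFieldIdeal K a := by
  refine le_antisymm (Ideal.span_le.2 ?_) (Ideal.span_le.2 ?_)
  · rintro _ ⟨_, ⟨c, rfl⟩, rfl⟩
    simp only [leadingTerm_maximalMinor]
    exact Ideal.mul_mem_left _ _ (Ideal.subset_span ⟨c, rfl⟩)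
  · rintro _ ⟨c, rfl⟩
    have h := Ideal.mul_mem_left (Ideal.span ((matchingOrder a w₀).leadingTerm ''
      Set.range fun c : Fin 3 ↪o Fin n => maximalMinor K c))
      (C (((Equiv.Perm.sign (matchingPerm a c) : ℤ) : K))⁻¹)
      (Ideal.subset_span ⟨_, ⟨c, rfl⟩, rfl⟩)
    simp only [leadingTerm_maximalMinor] at h
    rwa [← mul_assoc, ← C_mul, inv_mul_cancel₀ (cast_permSign_ne_zero K _), C_1, one_mul] at h

/-- The leading terms of the maximal minors generate the initial ideal, for every monomial order. -/
theorem initialIdeal_minorIdeal (K : Type*) [Field K] {n : ℕ} (m : MonomialOrder (Fin 3 × Fin n)) :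
    Ideal.span (m.leadingTerm '' Set.range fun c : Fin 3 ↪o Fin n => maximalMinor K c) =
      initialIdeal m (minorIdeal K n) := by
  refine le_antisymm (Ideal.span_mono (Set.image_mono Ideal.subset_span)) (Ideal.span_le.2 ?_)
  rintro _ ⟨f, hf, rfl⟩
  by_cases hf0 : f = 0
  · simp [hf0]
  obtain ⟨c, hc⟩ := exists_degree_maximalMinor_le m hf hf0
  obtain ⟨d, hd⟩ := exists_add_of_le hc
  have h0 : m.leadingCoeff (maximalMinor K c) ≠ 0 :=
    m.leadingCoeff_ne_zero_iff.2 (maximalMinor_ne_zero K c)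
  have h : m.leadingTerm f = monomial d (m.leadingCoeff f / m.leadingCoeff (maximalMinor K c)) *
      m.leadingTerm (maximalMinor K c) := by
    rw [MonomialOrder.leadingTerm, MonomialOrder.leadingTerm, monomial_mul, div_mul_cancel₀ _ h0,
      hd, add_comm]
  rw [SetLike.mem_coe, h]
  exact Ideal.mul_mem_left _ _ (Ideal.subset_span ⟨_, ⟨c, rfl⟩, rfl⟩)

theorem mainTheorem1 (K : Type*) [Field K] (n : ℕ) (a : Composition n) (w₀ : ℝ≥0) :
    matchingFieldIdeal K a = initialIdeal (matchingOrder a w₀) (minorIdeal K n) ∧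
      IsGroebnerBasis (matchingOrder a w₀)
        (Set.range fun c : Fin 3 ↪o Fin n => maximalMinor K c) (minorIdeal K n) :=
  ⟨(span_leadingTerm_maximalMinor K a w₀).symm.trans (initialIdeal_minorIdeal K _),
    Set.finite_range _, Ideal.subset_span, initialIdeal_minorIdeal K _⟩
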